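/- Let $\mathcal H$ be a complex Hilbert space. A closed real-linear subspace $H\subset\mathcal H$ is called standard if $\overline{H+iH}=\mathcal H$ and $H\cap iH=\{0\}$. For a standard subspace $H$ let $S_H:H+iH\to H+iH$, $h+ik\mapsto h-ik$ $(h,k\in H)$, be its Tomita operator, a closed densely defined antilinear involution, and let $\Delta_H=S_H^*S_H$ be its modular operator, a positive injective self-adjoint operator, so that the unitaries $\Delta_H^{it}$, $t\in\mathbb R$, are defined by functional calculus. An inclusion $\tilde H\subset H$ of standard subspaces of $\mathcal H$ is called a half-sided modular inclusion if $\Delta_H^{-it}\tilde H\subset\tilde H$ for all $t\ge 0$, and non-trivial if $\tilde H\ne H$. A conjugation on $\mathcal H$ is an antiunitary operator $\Gamma$ with $\Gamma^2=1$. Let $\tilde H\subset H$ be a non-trivial half-sided modular inclusion of standard subspaces of $\mathcal H$. Then there exists no conjugation $\Gamma$ on $\mathcal H$ with $\Gamma\tilde H=\tilde H$ and $\Gamma H=H$. -/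

import Mathlib

noncomputable section ModularTheory

open Filter Topology
open scoped ComplexInnerProductSpace

namespace StandardSubspace

variable {𝓗 : Type*} [NormedAddCommGroup 𝓗] [InnerProductSpace ℂ 𝓗]

/-- The complex subspace `D_H = H + iH`. -/
def tomitaDomain (H : StandardSubspace 𝓗) : Submodule ℂ 𝓗 where
  carrier := {x | ∃ h ∈ H.toClosedSubmodule, ∃ k ∈ H.toClosedSubmodule, x = h + Complex.I • k}
  zero_mem' := ⟨0, zero_mem _, 0, zero_mem _, by simp⟩
  add_mem' := by
    rintro _ _ ⟨h, hh, k, hk, rfl⟩ ⟨h', hh', k', hk', rfl⟩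
    exact ⟨h + h', add_mem hh hh', k + k', add_mem hk hk', by module⟩
  smul_mem' := by
    rintro c _ ⟨h, hh, k, hk, rfl⟩
    refine ⟨c.re • h + (-c.im) • k,
      add_mem (SMulMemClass.smul_mem _ hh) (SMulMemClass.smul_mem _ hk),
      c.im • h + c.re • k, add_mem (SMulMemClass.smul_mem _ hh) (SMulMemClass.smul_mem _ hk), ?_⟩
    conv_lhs => rw [← Complex.re_add_im c]
    simp only [← Complex.coe_smul]
    match_scalars <;> ring_nf
    simp [sub_eq_add_neg]

theorem eq_of_add_I_smul_eq (H : StandardSubspace 𝓗) {h k h' k' : 𝓗}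
    (hh : h ∈ H.toClosedSubmodule) (hk : k ∈ H.toClosedSubmodule)
    (hh' : h' ∈ H.toClosedSubmodule) (hk' : k' ∈ H.toClosedSubmodule)
    (e : h + Complex.I • k = h' + Complex.I • k') : h = h' ∧ k = k' := by
  have e1 : h - h' = Complex.I • (k' - k) := by
    rw [smul_sub, sub_eq_sub_iff_add_eq_add, e, add_comm]
  have m1 : h - h' ∈ H.toClosedSubmodule ⊓ H.toClosedSubmodule.mulI := by
    refine ⟨H.toClosedSubmodule.toSubmodule.sub_mem hh hh', ?_⟩
    refine (ClosedSubmodule.mem_mapEquiv_iff (f := scalarSMulCLE 𝓗 Complex.UnitI) _ _).2 ?_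
    have : (scalarSMulCLE 𝓗 Complex.UnitI).symm (h - h') = k' - k := by
      rw [e1]
      simp [Units.smul_def, smul_smul]
    rw [this]
    exact H.toClosedSubmodule.toSubmodule.sub_mem hk' hk
  rw [H.IsSeparating, ClosedSubmodule.mem_bot] at m1
  refine ⟨sub_eq_zero.1 m1, ?_⟩
  rw [m1] at e1
  have := (smul_eq_zero.1 e1.symm).resolve_left Complex.I_ne_zero
  exact (sub_eq_zero.1 this).symm

/-- The underlying map of the Tomita operator. -/
def tomitaFun (H : StandardSubspace 𝓗) (x : H.tomitaDomain) : 𝓗 :=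
  x.2.choose - Complex.I • x.2.choose_spec.2.choose

theorem tomitaFun_eq (H : StandardSubspace 𝓗) (x : H.tomitaDomain) {h k : 𝓗}
    (hh : h ∈ H.toClosedSubmodule) (hk : k ∈ H.toClosedSubmodule)
    (e : (x : 𝓗) = h + Complex.I • k) : H.tomitaFun x = h - Complex.I • k := by
  have h1 := x.2.choose_spec
  have h2 := h1.2.choose_spec
  obtain ⟨a, b⟩ := H.eq_of_add_I_smul_eq h1.1 h2.1 hh hk (h2.2.symm.trans e)
  rw [tomitaFun, b, a]

/-- The Tomita operator `S_H : H + iH → H + iH`, `h + ik ↦ h - ik`, an (in general unbounded)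
antilinear operator. -/
def tomita (H : StandardSubspace 𝓗) : 𝓗 →ₛₗ.[starRingEnd ℂ] 𝓗 where
  domain := H.tomitaDomain
  toFun :=
    { toFun := H.tomitaFun
      map_add' := by
        intro x y
        obtain ⟨h, hh, k, hk, hx⟩ := x.2
        obtain ⟨h', hh', k', hk', hy⟩ := y.2
        rw [H.tomitaFun_eq x hh hk hx, H.tomitaFun_eq y hh' hk' hy,
          H.tomitaFun_eq (x + y) (add_mem hh hh') (add_mem hk hk')
            (by rw [Submodule.coe_add, hx, hy]; module)]
        module
      map_smul' := by
        intro c x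
        obtain ⟨h, hh, k, hk, hx⟩ := x.2
        rw [H.tomitaFun_eq x hh hk hx,
          H.tomitaFun_eq (h := c.re • h + (-c.im) • k) (k := c.im • h + c.re • k) (c • x)
            (add_mem (SMulMemClass.smul_mem _ hh) (SMulMemClass.smul_mem _ hk))
            (add_mem (SMulMemClass.smul_mem _ hh) (SMulMemClass.smul_mem _ hk))]
        · have : starRingEnd ℂ c = c.re - c.im * Complex.I := by
            apply Complex.ext <;> simp
          rw [this]
          simp only [← Complex.coe_smul]
          match_scalars <;> ring_nf
          simp [sub_eq_add_neg]
        · rw [Submodule.coe_smul, hx]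
          conv_lhs => rw [← Complex.re_add_im c]
          simp only [← Complex.coe_smul]
          match_scalars <;> ring_nf
          simp [sub_eq_add_neg] }

theorem tomita_apply (H : StandardSubspace 𝓗) (x : H.tomita.domain) {h k : 𝓗}
    (hh : h ∈ H.toClosedSubmodule) (hk : k ∈ H.toClosedSubmodule)
    (e : (x : 𝓗) = h + Complex.I • k) : H.tomita x = h - Complex.I • k :=
  H.tomitaFun_eq x hh hk e

theorem dense_tomita_domain (H : StandardSubspace 𝓗) : Dense (H.tomita.domain : Set 𝓗) := by
  intro x
  have hx : x ∈ H.toClosedSubmodule ⊔ H.toClosedSubmodule.mulI := by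
    rw [H.IsCyclic]; exact ClosedSubmodule.mem_top
  rw [ClosedSubmodule.mem_sup] at hx
  refine closure_mono ?_ hx
  intro y hy
  obtain ⟨h, hh, k, hk, rfl⟩ := Submodule.mem_sup.1 hy
  obtain ⟨k', hk', rfl⟩ := hk
  exact ⟨h, hh, k', hk', rfl⟩

/-- `H.IsModularPair x z` says that `x` lies in the domain of `Δ_H = S_H^* S_H` and `Δ_H x = z`,
that is, `x ∈ dom S_H` and `S_H^* (S_H x) = z`. Recall that the adjoint of the antilinear operator
`S_H` is given by: `u ∈ dom S_H^*` and `S_H^* u = z` if and only if `⟪z, y⟫ = ⟪S_H y, u⟫` for all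
`y ∈ dom S_H`. (The inner product is antilinear in its first entry.) -/
def IsModularPair (H : StandardSubspace 𝓗) (x z : 𝓗) : Prop :=
  ∃ hx : x ∈ H.tomita.domain, ∀ y : H.tomita.domain, ⟪z, (y : 𝓗)⟫ = ⟪H.tomita y, H.tomita ⟨x, hx⟩⟫

theorem IsModularPair.unique {H : StandardSubspace 𝓗} {x z z' : 𝓗}
    (h : H.IsModularPair x z) (h' : H.IsModularPair x z') : z = z' := by
  obtain ⟨_, h⟩ := h
  obtain ⟨_, h'⟩ := h'
  exact H.dense_tomita_domain.eq_of_inner_left ℂ fun y hy => by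
    rw [h ⟨y, hy⟩, h' ⟨y, hy⟩]

theorem IsModularPair.add {H : StandardSubspace 𝓗} {x z x' z' : 𝓗}
    (h : H.IsModularPair x z) (h' : H.IsModularPair x' z') :
    H.IsModularPair (x + x') (z + z') := by
  obtain ⟨a, h⟩ := h
  obtain ⟨a', h'⟩ := h'
  refine ⟨add_mem a a', fun y => ?_⟩
  have : H.tomita ⟨x + x', add_mem a a'⟩ = H.tomita ⟨x, a⟩ + H.tomita ⟨x', a'⟩ :=
    H.tomita.map_add ⟨x, a⟩ ⟨x', a'⟩
  rw [this, inner_add_left, inner_add_right, h, h']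

theorem IsModularPair.smul {H : StandardSubspace 𝓗} {x z : 𝓗} (c : ℂ)
    (h : H.IsModularPair x z) : H.IsModularPair (c • x) (c • z) := by
  obtain ⟨a, h⟩ := h
  refine ⟨Submodule.smul_mem _ c a, fun y => ?_⟩
  have : H.tomita ⟨c • x, Submodule.smul_mem _ c a⟩ = starRingEnd ℂ c • H.tomita ⟨x, a⟩ :=
    H.tomita.toFun.map_smulₛₗ c ⟨x, a⟩
  rw [this, inner_smul_left, inner_smul_right, h]

/-- The modular operator `Δ_H = S_H^* S_H`, with its natural domain. -/
def modularOperator (H : StandardSubspace 𝓗) : 𝓗 →ₗ.[ℂ] 𝓗 where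
  domain :=
    { carrier := {x | ∃ z, H.IsModularPair x z}
      zero_mem' := ⟨0, H.tomita.domain.zero_mem, fun y => by
        have : H.tomita ⟨0, H.tomita.domain.zero_mem⟩ = 0 := H.tomita.map_zero
        rw [this]; simp⟩
      add_mem' := by
        rintro _ _ ⟨z, h⟩ ⟨z', h'⟩
        exact ⟨z + z', h.add h'⟩
      smul_mem' := by
        rintro c _ ⟨z, h⟩
        exact ⟨c • z, h.smul c⟩ }
  toFun :=
    { toFun := fun x => x.2.choose
      map_add' := fun x y => (x + y).2.choose_spec.unique
        (x.2.choose_spec.add y.2.choose_spec)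
      map_smul' := fun c x => (c • x).2.choose_spec.unique (x.2.choose_spec.smul c) }

theorem modularOperator_apply (H : StandardSubspace 𝓗) (x : H.modularOperator.domain) :
    H.IsModularPair x (H.modularOperator x) :=
  x.2.choose_spec

theorem modularOperator_eq (H : StandardSubspace 𝓗) (x : H.modularOperator.domain) {z : 𝓗}
    (h : H.IsModularPair x z) : H.modularOperator x = z :=
  (H.modularOperator_apply x).unique h

theorem IsModularPair.eq_of_sub {H : StandardSubspace 𝓗} {u x x' : 𝓗}
    (h : H.IsModularPair x (u - x)) (h' : H.IsModularPair x' (u - x')) : x = x' := by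
  have h3 : H.IsModularPair (x - x') (-(x - x')) := by
    have := h.add (h'.smul (-1))
    convert this using 1 <;> module
  obtain ⟨hx, h4⟩ := h3
  have h5 := congrArg Complex.re (h4 ⟨_, hx⟩)
  have e1 := inner_self_nonneg (𝕜 := ℂ) (x := x - x')
  have e2 := inner_self_nonneg (𝕜 := ℂ) (x := H.tomita ⟨_, hx⟩)
  simp only [RCLike.re_to_complex] at e1 e2
  rw [inner_neg_left, Complex.neg_re] at h5
  have e3 : RCLike.re ⟪x - x', x - x'⟫ ≤ 0 := by
    simp only [RCLike.re_to_complex]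
    linarith
  exact sub_eq_zero.1 (re_inner_self_nonpos.1 e3)

theorem IsModularPair.inner_eq {H : StandardSubspace 𝓗} {x z : 𝓗} (h : H.IsModularPair x z) :
    ⟪z, x⟫ = (‖H.tomita ⟨x, h.1⟩‖ ^ 2 : ℝ) := by
  rw [h.2 ⟨x, h.1⟩, inner_self_eq_norm_sq_to_K]
  norm_cast

section Resolvent

variable [CompleteSpace 𝓗]

theorem exists_real_projection (H : StandardSubspace 𝓗) (u : 𝓗) :
    ∃ p ∈ H.toClosedSubmodule, ∀ h ∈ H.toClosedSubmodule, ⟪u - p, h⟫.re = 0 := by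
  have hc : IsComplete (H.toClosedSubmodule.toSubmodule : Set 𝓗) :=
    H.toClosedSubmodule.isClosed.isComplete
  obtain ⟨p, hp, e⟩ :=
    @Submodule.exists_norm_eq_iInf_of_complete_subspace ℝ 𝓗 _ _ InnerProductSpace.complexToReal
    H.toClosedSubmodule.toSubmodule hc u
  refine ⟨p, hp, ?_⟩
  exact (@Submodule.norm_eq_iInf_iff_real_inner_eq_zero 𝓗 _ InnerProductSpace.complexToReal
    H.toClosedSubmodule.toSubmodule u p hp).1 e

/-- `1 + Δ_H` is surjective. -/
theorem exists_isModularPair_sub (H : StandardSubspace 𝓗) (u : 𝓗) :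
    ∃ x, H.IsModularPair x (u - x) := by
  obtain ⟨p, hp, hpu⟩ := H.exists_real_projection u
  obtain ⟨q, hq, hqu⟩ := H.exists_real_projection (-(Complex.I • u))
  have hp' : (2⁻¹ : ℝ) • p ∈ H.toClosedSubmodule := SMulMemClass.smul_mem _ hp
  have hq' : (2⁻¹ : ℝ) • q ∈ H.toClosedSubmodule := SMulMemClass.smul_mem _ hq
  have hx : (2⁻¹ : ℝ) • p + Complex.I • (2⁻¹ : ℝ) • q ∈ H.tomita.domain :=
    ⟨_, hp', _, hq', rfl⟩
  refine ⟨_, hx, ?_⟩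
  have key : ∀ h ∈ H.toClosedSubmodule,
      ⟪u - ((2⁻¹ : ℝ) • p + Complex.I • (2⁻¹ : ℝ) • q), h⟫ =
        ⟪h, (2⁻¹ : ℝ) • p - Complex.I • (2⁻¹ : ℝ) • q⟫ := by
    intro h hh
    have h1 := hpu h hh
    have h2 := hqu h hh
    have s1 : ⟪h, p⟫.re = ⟪p, h⟫.re := inner_re_symm (𝕜 := ℂ) h p
    have s2 : ⟪h, q⟫.im = -⟪q, h⟫.im := inner_im_symm (𝕜 := ℂ) h q
    have s3 : ⟪h, p⟫.im = -⟪p, h⟫.im := inner_im_symm (𝕜 := ℂ) h p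
    have s4 : ⟪h, q⟫.re = ⟪q, h⟫.re := inner_re_symm (𝕜 := ℂ) h q
    simp only [← Complex.coe_smul, inner_sub_left, inner_add_left, inner_smul_left,
      inner_neg_left, inner_sub_right, inner_smul_right] at h1 h2 ⊢
    simp only [Complex.sub_re, Complex.neg_re, Complex.mul_re, Complex.conj_re, Complex.conj_im,
      Complex.I_re, Complex.I_im] at h1 h2
    apply Complex.ext
    · simp
      linarith [s1, s2]
    · simp
      linarith [s3, s4]
  intro y
  obtain ⟨h, hh, k, hk, hy⟩ := y.2
  rw [H.tomita_apply y hh hk hy, H.tomita_apply ⟨_, hx⟩ hp' hq' rfl, hy, inner_add_right,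
    inner_smul_right, key h hh, key k hk, inner_sub_left h, inner_smul_left,
    Complex.conj_I]
  ring

/-- The bounded operator `(1 + Δ_H)⁻¹`. -/
def modularResolvent (H : StandardSubspace 𝓗) : 𝓗 →L[ℂ] 𝓗 :=
  LinearMap.mkContinuous
    { toFun := fun u => (H.exists_isModularPair_sub u).choose
      map_add' := fun u v => by
        refine (H.exists_isModularPair_sub (u + v)).choose_spec.eq_of_sub ?_
        convert (H.exists_isModularPair_sub u).choose_spec.add
          (H.exists_isModularPair_sub v).choose_spec using 1
        abel
      map_smul' := fun c u => by
        refine (H.exists_isModularPair_sub (c • u)).choose_spec.eq_of_sub ?_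
        rw [RingHom.id_apply, ← smul_sub]
        exact (H.exists_isModularPair_sub u).choose_spec.smul c }
    1 fun u => by
      set x := (H.exists_isModularPair_sub u).choose with hx
      have h : H.IsModularPair x (u - x) := (H.exists_isModularPair_sub u).choose_spec
      have h1 := congrArg Complex.re h.inner_eq
      rw [inner_sub_left, Complex.sub_re, Complex.ofReal_re] at h1
      have h2 : ⟪x, x⟫.re = ‖x‖ ^ 2 := inner_self_eq_norm_sq (𝕜 := ℂ) x
      have h3 : ⟪u, x⟫.re ≤ ‖u‖ * ‖x‖ := re_inner_le_norm (𝕜 := ℂ) u x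
      have h4 : ‖x‖ * ‖x‖ ≤ ‖u‖ * ‖x‖ := by nlinarith [sq_nonneg ‖H.tomita ⟨x, h.1⟩‖]
      change ‖x‖ ≤ 1 * ‖u‖
      rw [one_mul]
      rcases (norm_nonneg x).eq_or_lt with h5 | h5
      · rw [← h5]; positivity
      · exact le_of_mul_le_mul_right h4 h5

theorem modularResolvent_spec (H : StandardSubspace 𝓗) (u : 𝓗) :
    H.IsModularPair (H.modularResolvent u) (u - H.modularResolvent u) :=
  (H.exists_isModularPair_sub u).choose_spec

/-- `modularResolvent` is a right inverse of `1 + Δ_H`. -/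
theorem modularResolvent_add_modularOperator (H : StandardSubspace 𝓗) (u : 𝓗) :
    ∃ hu : H.modularResolvent u ∈ H.modularOperator.domain,
      H.modularResolvent u + H.modularOperator ⟨H.modularResolvent u, hu⟩ = u :=
  ⟨⟨_, H.modularResolvent_spec u⟩, by
    rw [H.modularOperator_eq _ (H.modularResolvent_spec u)]; abel⟩

/-- `modularResolvent` is a left inverse of `1 + Δ_H`. -/
theorem modularResolvent_apply_add (H : StandardSubspace 𝓗) (x : H.modularOperator.domain) :
    H.modularResolvent (x + H.modularOperator x) = x := by
  refine (H.modularResolvent_spec _).eq_of_sub ?_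
  rw [add_sub_cancel_left]
  exact H.modularOperator_apply x

theorem isSelfAdjoint_modularResolvent (H : StandardSubspace 𝓗) :
    IsSelfAdjoint H.modularResolvent := by
  rw [ContinuousLinearMap.isSelfAdjoint_iff_isSymmetric]
  intro u v
  have h1 := H.modularResolvent_spec u
  have h2 := H.modularResolvent_spec v
  have e1 := h2.2 ⟨_, h1.1⟩
  have e2 := h1.2 ⟨_, h2.1⟩
  simp only [ContinuousLinearMap.coe_coe]
  rw [inner_sub_left] at e1 e2
  rw [← inner_conj_symm _ v, sub_eq_iff_eq_add.1 e1, sub_eq_iff_eq_add.1 e2, map_add,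
    inner_conj_symm, inner_conj_symm]

theorem modularResolvent_nonneg (H : StandardSubspace 𝓗) : 0 ≤ H.modularResolvent := by
  rw [ContinuousLinearMap.nonneg_iff_isPositive]
  refine ⟨(ContinuousLinearMap.isSelfAdjoint_iff_isSymmetric).1 H.isSelfAdjoint_modularResolvent,
    fun u => ?_⟩
  have h := H.modularResolvent_spec u
  have h1 := congrArg Complex.re h.inner_eq
  rw [inner_sub_left, Complex.sub_re, Complex.ofReal_re] at h1
  have h2 : ⟪H.modularResolvent u, H.modularResolvent u⟫.re = ‖H.modularResolvent u‖ ^ 2 :=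
    inner_self_eq_norm_sq (𝕜 := ℂ) _
  have h3 : ⟪H.modularResolvent u, u⟫.re = ⟪u, H.modularResolvent u⟫.re :=
    inner_re_symm (𝕜 := ℂ) _ _
  rw [ContinuousLinearMap.reApplyInnerSelf_apply, RCLike.re_to_complex, h3]
  nlinarith [sq_nonneg ‖H.tomita ⟨_, h.1⟩‖, sq_nonneg ‖H.modularResolvent u‖]

theorem norm_modularResolvent_le (H : StandardSubspace 𝓗) : ‖H.modularResolvent‖ ≤ 1 :=
  LinearMap.mkContinuous_norm_le _ zero_le_one _

theorem spectrum_modularResolvent (H : StandardSubspace 𝓗) {z : ℂ}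
    (hz : z ∈ spectrum ℂ H.modularResolvent) : ∃ a ∈ Set.Icc (0 : ℝ) 1, z = a := by
  have h1 : z = z.re := H.isSelfAdjoint_modularResolvent.mem_spectrum_eq_re hz
  have h2 : z.re ∈ spectrum ℝ H.modularResolvent := by
    rw [h1] at hz
    exact spectrum.of_algebraMap_mem ℂ hz
  refine ⟨z.re, ⟨spectrum_nonneg_of_nonneg H.modularResolvent_nonneg h2, ?_⟩, h1⟩
  have h3 := spectrum.norm_le_norm_mul_of_mem hz
  have h4 : ‖(1 : 𝓗 →L[ℂ] 𝓗)‖ ≤ 1 := ContinuousLinearMap.norm_id_le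
  calc z.re ≤ ‖z‖ := Complex.re_le_norm z
    _ ≤ ‖H.modularResolvent‖ * ‖(1 : 𝓗 →L[ℂ] 𝓗)‖ := h3
    _ ≤ 1 * 1 := by gcongr; exact H.norm_modularResolvent_le
    _ = 1 := one_mul 1

/-- The continuous functional calculus `f(Δ_H)`, for functions `f` that are continuous on `[0, ∞)`
with `f(0) = f(∞) = 0`. Since `A = (1 + Δ_H)⁻¹` is a bounded operator with spectrum in `[0, 1]`
and `Δ_H = (1 - A) / A`, the operator `f(Δ_H)` is the function `a ↦ f((1 - a) / a)` of `A`. -/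
def modularFunction (H : StandardSubspace 𝓗) (f : ℝ → ℂ) : 𝓗 →L[ℂ] 𝓗 :=
  cfc (fun a : ℂ => f ((1 - a.re) / a.re)) H.modularResolvent

end Resolvent

/-- The function `s ↦ s^{it} (s / (1 + s)²)^ε` on `[0, ∞)`. For `ε > 0` it is continuous, bounded
by `1` in absolute value, and vanishes at `0` and at `∞`; as `ε → 0`, it converges pointwise on
`(0, ∞)` to `s^{it}`. -/
def regImagPow (t ε s : ℝ) : ℂ :=
  (s : ℂ) ^ (t * Complex.I) * ((s / (1 + s) ^ 2) ^ ε : ℝ)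

/-- `regImagPow` in the variable `a = 1 / (1 + s)`. -/
def regImagPowAux (t ε : ℝ) (a : ℂ) : ℂ := regImagPow t ε ((1 - a.re) / a.re)

theorem regImagPowAux_eq (t ε : ℝ) {a : ℝ} (ha : a ∈ Set.Icc (0 : ℝ) 1) :
    regImagPowAux t ε a =
      (((1 - a) / a : ℝ) : ℂ) ^ (t * Complex.I) * ((a * (1 - a)) ^ ε : ℝ) := by
  rw [regImagPowAux, regImagPow, Complex.ofReal_re]
  rcases ha.1.eq_or_lt with rfl | h
  · simp
  · congr 4
    field_simp
    ring

theorem norm_regImagPowAux_le (t ε : ℝ) {a : ℝ} (ha : a ∈ Set.Icc (0 : ℝ) 1) :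
    ‖regImagPowAux t ε a‖ ≤ (a * (1 - a)) ^ ε := by
  have h1 : 0 ≤ a * (1 - a) := mul_nonneg ha.1 (by linarith [ha.2])
  rw [regImagPowAux_eq t ε ha, norm_mul, Complex.norm_real, Real.norm_eq_abs, abs_of_nonneg
    (Real.rpow_nonneg h1 _)]
  refine mul_le_of_le_one_left (Real.rpow_nonneg h1 _) ?_
  rcases h1.eq_or_lt with h2 | h2
  · rcases mul_eq_zero.1 h2.symm with h3 | h3 <;> simp only [h3] <;>
    · by_cases ht : t = 0 <;> simp [ht]
  · have h3 : 0 < (1 - a) / a := by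
      have : 0 < a := lt_of_le_of_ne ha.1 (by rintro rfl; simp at h2)
      have : 0 < 1 - a := pos_of_mul_pos_right h2 ha.1
      positivity
    rw [Complex.norm_cpow_eq_rpow_re_of_pos h3]
    simp

theorem continuousOn_regImagPowAux (t : ℝ) {ε : ℝ} (hε : 0 < ε) :
    ContinuousOn (fun a : ℝ => regImagPowAux t ε a) (Set.Icc 0 1) := by
  intro a ha
  have hcont : Tendsto (fun a : ℝ => (a * (1 - a)) ^ ε) (𝓝[Set.Icc 0 1] a)
      (𝓝 ((a * (1 - a)) ^ ε)) := by
    refine (Continuous.continuousAt ?_).continuousWithinAt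
    exact (by fun_prop : Continuous fun a : ℝ => a * (1 - a)).rpow_const fun _ => Or.inr hε.le
  rcases (mul_nonneg ha.1 (sub_nonneg.2 ha.2) : 0 ≤ a * (1 - a)).eq_or_lt with h0 | h0
  · have e : regImagPowAux t ε a = 0 := by
      rw [← norm_le_zero_iff]
      refine (norm_regImagPowAux_le t ε ha).trans_eq ?_
      rw [← h0, Real.zero_rpow hε.ne']
    rw [ContinuousWithinAt, e]
    rw [← h0, Real.zero_rpow hε.ne'] at hcont
    refine squeeze_zero_norm' ?_ hcont
    filter_upwards [self_mem_nhdsWithin] with b hb using norm_regImagPowAux_le t ε hb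
  · have ha0 : 0 < a := lt_of_le_of_ne ha.1 (by rintro rfl; simp at h0)
    have ha1 : 0 < 1 - a := pos_of_mul_pos_right h0 ha.1
    have hpos : 0 < (1 - a) / a := by positivity
    refine ContinuousWithinAt.congr (f := fun a : ℝ =>
      (((1 - a) / a : ℝ) : ℂ) ^ (t * Complex.I) * ((a * (1 - a)) ^ ε : ℝ)) ?_
      (fun b hb => regImagPowAux_eq t ε hb) (regImagPowAux_eq t ε ha)
    refine ContinuousWithinAt.mul ?_ (Complex.continuous_ofReal.continuousAt.tendsto.comp hcont)
    refine ContinuousAt.continuousWithinAt ?_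
    refine ContinuousAt.comp (f := fun a : ℝ => (1 - a) / a)
      (g := fun r : ℝ => (r : ℂ) ^ (t * Complex.I)) ?_ (by fun_prop (disch := exact ha0.ne'))
    refine ContinuousAt.cpow Complex.continuous_ofReal.continuousAt continuousAt_const ?_
    exact Or.inl (by simpa using hpos)

section Limit

variable [CompleteSpace 𝓗]

theorem continuousOn_regImagPowAux_spectrum (H : StandardSubspace 𝓗) (t : ℝ) {ε : ℝ} (hε : 0 < ε) :
    ContinuousOn (regImagPowAux t ε) (spectrum ℂ H.modularResolvent) := by
  have h : ContinuousOn (fun z : ℂ => regImagPowAux t ε (z.re : ℝ))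
      (spectrum ℂ H.modularResolvent) := by
    refine (continuousOn_regImagPowAux t hε).comp Complex.continuous_re.continuousOn ?_
    intro z hz
    obtain ⟨a, ha, rfl⟩ := H.spectrum_modularResolvent hz
    exact ha
  exact h

theorem norm_modularFunction_reg_le (H : StandardSubspace 𝓗) (t : ℝ) {ε : ℝ} (hε : 0 < ε) :
    ‖H.modularFunction (regImagPow t ε)‖ ≤ 1 := by
  refine norm_cfc_le zero_le_one fun z hz => ?_
  obtain ⟨a, ha, rfl⟩ := H.spectrum_modularResolvent hz
  refine (norm_regImagPowAux_le t ε ha).trans ?_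
  exact Real.rpow_le_one (mul_nonneg ha.1 (by linarith [ha.2])) (by nlinarith [ha.1, ha.2]) hε.le

theorem norm_regImagPowAux_sub_le (t : ℝ) {ε : ℝ} (hε : 0 < ε) {a : ℝ}
    (ha : a ∈ Set.Icc (0 : ℝ) 1) :
    ‖regImagPowAux t ε a * (a * (1 - a)) - regImagPowAux t 1 a‖ ≤ ε := by
  have h1 : 0 ≤ a * (1 - a) := mul_nonneg ha.1 (by linarith [ha.2])
  rcases h1.eq_or_lt with h2 | h2
  · have e : ((a : ℂ) * (1 - a)) = 0 := by exact_mod_cast h2.symm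
    have := norm_regImagPowAux_le t 1 ha
    rw [← h2, Real.zero_rpow one_ne_zero] at this
    rw [e, mul_zero, zero_sub, norm_neg]
    linarith
  · have h4 : a * (1 - a) ≤ 1 := by nlinarith [ha.1, ha.2]
    set s := a * (1 - a) with hs
    have e : ((a : ℂ) * (1 - a)) = (s : ℂ) := by rw [hs]; push_cast; ring
    rw [e, regImagPowAux_eq t ε ha, regImagPowAux_eq t 1 ha, ← hs, Real.rpow_one]
    have h3 : 0 < (1 - a) / a := by
      have : 0 < a := lt_of_le_of_ne ha.1 (by rintro rfl; simp [hs] at h2)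
      have : 0 < 1 - a := pos_of_mul_pos_right h2 ha.1
      positivity
    have e2 : (((1 - a) / a : ℝ) : ℂ) ^ (t * Complex.I) * ((s ^ ε : ℝ) : ℂ) * (s : ℂ) -
        (((1 - a) / a : ℝ) : ℂ) ^ (t * Complex.I) * (s : ℂ) =
        (((1 - a) / a : ℝ) : ℂ) ^ (t * Complex.I) * ((s * (s ^ ε - 1) : ℝ) : ℂ) := by
      push_cast; ring
    rw [e2, norm_mul, Complex.norm_cpow_eq_rpow_re_of_pos h3, Complex.norm_real]
    have h5 : s ^ ε ≤ 1 := Real.rpow_le_one h2.le h4 hε.le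
    have h6 : 1 + ε * Real.log s ≤ s ^ ε := by
      rw [Real.rpow_def_of_pos h2, mul_comm (Real.log s)]
      linarith [Real.add_one_le_exp (ε * Real.log s)]
    have h7 := Real.one_sub_inv_le_log_of_pos h2
    have h8 : s - 1 ≤ s * Real.log s := by
      have := mul_le_mul_of_nonneg_left h7 h2.le
      rwa [mul_sub, mul_inv_cancel₀ h2.ne', mul_one] at this
    rw [Real.norm_eq_abs, abs_of_nonpos (mul_nonpos_of_nonneg_of_nonpos h2.le (by linarith))]
    simp
    nlinarith

theorem modularFunction_reg_apply (H : StandardSubspace 𝓗) (t : ℝ) {ε : ℝ} (hε : 0 < ε) (x : 𝓗) :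
    ‖H.modularFunction (regImagPow t ε)
        (H.modularResolvent (x - H.modularResolvent x)) -
      H.modularFunction (regImagPow t 1) x‖ ≤ ε * ‖x‖ := by
  have hA : IsStarNormal H.modularResolvent := H.isSelfAdjoint_modularResolvent.isStarNormal
  have c1 := H.continuousOn_regImagPowAux_spectrum t hε
  have c2 := H.continuousOn_regImagPowAux_spectrum t one_pos
  have e1 : H.modularResolvent * (1 - H.modularResolvent) =
      cfc (fun a : ℂ => a * (1 - a)) H.modularResolvent := by
    rw [cfc_mul (fun a : ℂ => a) (fun a : ℂ => 1 - a), cfc_sub (fun _ : ℂ => 1) (fun a : ℂ => a),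
      cfc_id' ℂ H.modularResolvent, cfc_const_one ℂ H.modularResolvent]
  have e2 : H.modularFunction (regImagPow t ε) * (H.modularResolvent * (1 - H.modularResolvent)) -
      H.modularFunction (regImagPow t 1) =
      cfc (fun a : ℂ => regImagPowAux t ε a * (a * (1 - a)) - regImagPowAux t 1 a)
        H.modularResolvent := by
    rw [cfc_sub (fun a : ℂ => regImagPowAux t ε a * (a * (1 - a))) (regImagPowAux t 1)
      H.modularResolvent (c1.mul (by fun_prop)) c2,
      cfc_mul (regImagPowAux t ε) (fun a : ℂ => a * (1 - a)) H.modularResolvent c1 (by fun_prop),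
      ← e1]
    rfl
  have e3 : ‖H.modularFunction (regImagPow t ε) *
      (H.modularResolvent * (1 - H.modularResolvent)) -
      H.modularFunction (regImagPow t 1)‖ ≤ ε := by
    rw [e2]
    refine norm_cfc_le hε.le fun z hz => ?_
    obtain ⟨a, ha, rfl⟩ := H.spectrum_modularResolvent hz
    exact norm_regImagPowAux_sub_le t hε ha
  have e4 := (H.modularFunction (regImagPow t ε) *
    (H.modularResolvent * (1 - H.modularResolvent)) -
      H.modularFunction (regImagPow t 1)).le_opNorm x
  exact e4.trans (mul_le_mul_of_nonneg_right e3 (norm_nonneg x))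

theorem isModularPair_zero (H : StandardSubspace 𝓗) : H.IsModularPair 0 0 := by
  simpa using (H.modularResolvent_spec 0).smul 0

theorem dense_range_modular (H : StandardSubspace 𝓗) :
    DenseRange fun x : 𝓗 => H.modularResolvent (x - H.modularResolvent x) := by
  have hs := (ContinuousLinearMap.isSelfAdjoint_iff_isSymmetric).1 H.isSelfAdjoint_modularResolvent
  have hs' : ∀ x y, ⟪H.modularResolvent x, y⟫ = ⟪x, H.modularResolvent y⟫ := hs
  let B : 𝓗 →L[ℂ] 𝓗 := H.modularResolvent * (1 - H.modularResolvent)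
  have hB : (LinearMap.range (B : 𝓗 →ₗ[ℂ] 𝓗)).topologicalClosure = ⊤ := by
    rw [Submodule.topologicalClosure_eq_top_iff, Submodule.eq_bot_iff]
    intro v hv
    have h1 : H.modularResolvent (v - H.modularResolvent v) = 0 := by
      refine ext_inner_left ℂ fun x => ?_
      have h2 : ⟪H.modularResolvent (x - H.modularResolvent x), v⟫ = 0 :=
        (Submodule.mem_orthogonal _ _).1 hv _ ⟨x, rfl⟩
      rw [hs', inner_sub_left, hs'] at h2
      rw [inner_zero_right, map_sub, inner_sub_right, h2]
    have h3 := H.modularResolvent_spec (v - H.modularResolvent v)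
    rw [h1, sub_zero] at h3
    have h4 := sub_eq_zero.1 (h3.unique H.isModularPair_zero)
    have h5 := H.modularResolvent_spec v
    rw [← h4, sub_self] at h5
    have h6 := h5.inner_eq
    rw [inner_zero_left] at h6
    have h7 : H.tomita ⟨v, h5.1⟩ = 0 := by
      have : ‖H.tomita ⟨v, h5.1⟩‖ ^ 2 = 0 := by exact_mod_cast h6.symm
      simpa using this
    obtain ⟨h, hh, k, hk, e⟩ := h5.1
    rw [H.tomita_apply _ hh hk e] at h7
    obtain ⟨a, b⟩ := H.eq_of_add_I_smul_eq hh (H.toClosedSubmodule.toSubmodule.neg_mem hk)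
      (zero_mem _) (zero_mem _) (by rw [smul_neg, ← sub_eq_add_neg, h7]; simp)
    rw [e, a, neg_eq_zero.1 b]
    simp
  exact (Submodule.dense_iff_topologicalClosure_eq_top).2 hB

/-- The strong limit defining `Δ_H^{it}` exists. -/
theorem exists_tendsto_modularFunction (H : StandardSubspace 𝓗) (t : ℝ) (x : 𝓗) :
    ∃ y, Tendsto (fun ε : ℝ => H.modularFunction (regImagPow t ε) x) (𝓝[>] 0) (𝓝 y) := by
  refine cauchy_map_iff_exists_tendsto.1 (Metric.cauchy_iff.2 ⟨inferInstance, fun δ hδ => ?_⟩)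
  obtain ⟨w, hw⟩ := H.dense_range_modular.exists_dist_lt x (show 0 < δ / 4 by positivity)
  have hev : ∀ᶠ ε : ℝ in 𝓝[>] 0, 0 < ε ∧ ε * ‖w‖ < δ / 4 := by
    refine eventually_mem_nhdsWithin.and (nhdsWithin_le_nhds ?_)
    refine (by fun_prop : Continuous fun ε : ℝ => ε * ‖w‖).tendsto 0 |>.eventually_lt_const ?_
    rw [zero_mul]; positivity
  have key : ∀ ε : ℝ, 0 < ε ∧ ε * ‖w‖ < δ / 4 →
      dist (H.modularFunction (regImagPow t ε) x) (H.modularFunction (regImagPow t 1) w)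
        < δ / 2 := by
    rintro ε ⟨hε, hε'⟩
    have h1 := H.modularFunction_reg_apply t hε w
    have h2 : dist (H.modularFunction (regImagPow t ε) x) (H.modularFunction (regImagPow t ε)
        (H.modularResolvent (w - H.modularResolvent w))) < δ / 4 := by
      rw [dist_eq_norm, ← map_sub]
      refine (ContinuousLinearMap.le_of_opNorm_le _ (H.norm_modularFunction_reg_le t hε) _).trans_lt
        ?_
      rwa [one_mul, ← dist_eq_norm]
    rw [← dist_eq_norm] at h1
    linarith [dist_triangle (H.modularFunction (regImagPow t ε) x) (H.modularFunction
      (regImagPow t ε) (H.modularResolvent (w - H.modularResolvent w)))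
      (H.modularFunction (regImagPow t 1) w)]
  refine ⟨_, image_mem_map hev, ?_⟩
  rintro _ ⟨ε, hε, rfl⟩ _ ⟨ε', hε', rfl⟩
  linarith [key ε hε, key ε' hε', dist_triangle_right (H.modularFunction (regImagPow t ε) x)
    (H.modularFunction (regImagPow t ε') x) (H.modularFunction (regImagPow t 1) w)]

/-- The modular unitary `Δ_H^{it}`, `t ∈ ℝ`, obtained from the functional calculus of the positive
injective self-adjoint operator `Δ_H` as the strong limit of `f_ε(Δ_H)` as `ε → 0`, where
`f_ε(s) = s^{it} (s / (1 + s)²)^ε` is bounded by `1` and converges pointwise to `s^{it}`. -/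
def modularUnitary (H : StandardSubspace 𝓗) (t : ℝ) (x : 𝓗) : 𝓗 :=
  limUnder (𝓝[>] 0) fun ε : ℝ => H.modularFunction (regImagPow t ε) x

theorem tendsto_modularUnitary (H : StandardSubspace 𝓗) (t : ℝ) (x : 𝓗) :
    Tendsto (fun ε : ℝ => H.modularFunction (regImagPow t ε) x) (𝓝[>] 0)
      (𝓝 (H.modularUnitary t x)) :=
  tendsto_nhds_limUnder (H.exists_tendsto_modularFunction t x)

/-- An inclusion `K ⊆ H` of standard subspaces is half-sided modular if `Δ_H^{-it} K ⊆ K` for all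
`t ≥ 0`. -/
structure IsHalfSidedModularInclusion (K H : StandardSubspace 𝓗) : Prop where
  le : K.toClosedSubmodule ≤ H.toClosedSubmodule
  image_subset : ∀ t : ℝ, 0 ≤ t →
    H.modularUnitary (-t) '' (K.toClosedSubmodule : Set 𝓗) ⊆ K.toClosedSubmodule

end Limit

end StandardSubspace

/-- A conjugation is an antiunitary (that is, surjective, isometric and antilinear) involution. -/
def IsConjugation {𝓗 : Type*} [NormedAddCommGroup 𝓗] [InnerProductSpace ℂ 𝓗]
    (Γ : 𝓗 ≃ₗᵢ⋆[ℂ] 𝓗) : Prop :=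
  Function.Involutive Γ

end ModularTheory

section ModularInvariance

open Filter Topology
open scoped ComplexInnerProductSpace

namespace StandardSubspace

variable {𝓗 : Type*} [NormedAddCommGroup 𝓗] [InnerProductSpace ℂ 𝓗]

/-! Write `K` for the smaller subspace, and suppose `Γ` preserves `K` and `H`. Then `Γ` commutes
with `S_H`, hence with `Δ_H`. Since `Γ` is antilinear, conjugation by `Γ` turns `f(Δ_H)` into the
operator of the complex conjugate function, so `Γ Δ_H^{it} Γ = Δ_H^{-it}`
(`modularUnitary_neg_conjugation`). One-sided invariance of `K` under the modular group therefore
becomes invariance for all real `t`, and it remains to show that a standard subspace `K ⊆ H`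
invariant under the whole modular group equals `H` (`eq_of_le_of_modularUnitary_mem`).

For this put `A = (1 + Δ_H)⁻¹` and `T = i(2A - 1) = -i tanh(log Δ_H / 2)`. For `k ∈ H` the
difference `ik - Tk` is real-orthogonal to `H`. If `T` maps `K` into itself, then a vector `g ∈ H`
that is real-orthogonal to `K` is also real-orthogonal to `iK`, hence zero by cyclicity of `K`.
Applied to `g = h - p`, with `p` the real projection of `h ∈ H` to `K`, this gives `h ∈ K`
(`eq_of_le_of_resolvent_mem`).

Invariance under `T` follows by approximation. As `K` is closed and real-linear, it is preserved by
real combinations of the `Δ_H^{it}`. The symbol `φ(l) = -i tanh(l / 2)` satisfies `conj φ(-l) =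
φ(l)`, the symmetry of trigonometric polynomials with real coefficients, and such polynomials
approximate it in a weighted norm (`exists_realTrig_near`), which suffices for strong approximation
of `T` (`resolvent_mem_of_modularUnitary_mem`). -/

theorem mem_tomita_domain (H : StandardSubspace 𝓗) {h : 𝓗} (hh : h ∈ H.toClosedSubmodule) :
    h ∈ H.tomita.domain :=
  ⟨h, hh, 0, zero_mem _, by simp⟩

theorem tomita_apply_of_mem (H : StandardSubspace 𝓗) {h : 𝓗} (hh : h ∈ H.toClosedSubmodule) :
    H.tomita ⟨h, H.mem_tomita_domain hh⟩ = h := by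
  rw [H.tomita_apply _ hh (zero_mem _) (by simp)]
  simp

/-- A vector that is real-orthogonal to `K` and to `iK` vanishes, because `K` is cyclic. -/
theorem eq_zero_of_re_inner_eq_zero (K : StandardSubspace 𝓗) {g : 𝓗}
    (h1 : ∀ k ∈ K.toClosedSubmodule, ⟪g, k⟫.re = 0)
    (h2 : ∀ k ∈ K.toClosedSubmodule, ⟪g, Complex.I • k⟫.re = 0) : g = 0 := by
  refine K.dense_tomita_domain.eq_zero_of_inner_left ℂ fun y hy => ?_
  obtain ⟨h, hh, k, hk, e⟩ := hy
  have key : ∀ k ∈ K.toClosedSubmodule, ⟪g, k⟫ = 0 := fun k hk =>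
    Complex.ext (h1 k hk) (by simpa [inner_smul_right] using h2 k hk)
  rw [e, inner_add_right, inner_smul_right, key h hh, key k hk]
  simp

/-! ### Conjugations and the modular operator. -/

section Conjugation

variable {H : StandardSubspace 𝓗} {Γ : 𝓗 ≃ₗᵢ⋆[ℂ] 𝓗}

/-- Polarization: preservation of norms fixes the real part, and replacing `y` by `iy` gives the
imaginary part, with the sign flip due to antilinearity. -/
theorem inner_conjugation (Γ : 𝓗 ≃ₗᵢ⋆[ℂ] 𝓗) (x y : 𝓗) : ⟪Γ x, Γ y⟫ = ⟪y, x⟫ := by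
  have key : ∀ x y : 𝓗, ⟪Γ x, Γ y⟫.re = ⟪y, x⟫.re := fun x y => by
    have h1 := norm_add_sq (𝕜 := ℂ) (Γ x) (Γ y)
    have h2 := norm_add_sq (𝕜 := ℂ) y x
    rw [← map_add, Γ.norm_map, Γ.norm_map, Γ.norm_map, add_comm x y, h2] at h1
    simp only [RCLike.re_to_complex] at h1
    linarith
  refine Complex.ext (key x y) ?_
  have h := key x (Complex.I • y)
  rw [LinearIsometryEquiv.map_smulₛₗ] at h
  simpa [inner_smul_right, inner_smul_left] using h

/-- `Γ` commutes with `S_H` because `Γ(h + ik) = Γh - iΓk` with `Γh, Γk ∈ H`. The adjoint relation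
is then transported by testing it on `Γy` instead of `y`. -/
theorem IsModularPair.conjugation (hΓ : IsConjugation Γ)
    (hH : ∀ h ∈ H.toClosedSubmodule, Γ h ∈ H.toClosedSubmodule) {x z : 𝓗}
    (hxz : H.IsModularPair x z) : H.IsModularPair (Γ x) (Γ z) := by
  have key : ∀ y : H.tomita.domain, ∃ hy : Γ y ∈ H.tomita.domain,
      H.tomita ⟨Γ y, hy⟩ = Γ (H.tomita y) := by
    intro y
    obtain ⟨h, hh, k, hk, e⟩ := y.2
    have hk' := H.toClosedSubmodule.toSubmodule.neg_mem (hH k hk)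
    have e' : Γ y = Γ h + Complex.I • (-Γ k) := by
      rw [e, map_add, LinearIsometryEquiv.map_smulₛₗ]; simp
    have hy : Γ y ∈ H.tomita.domain := ⟨_, hH h hh, _, hk', e'⟩
    refine ⟨hy, ?_⟩
    rw [H.tomita_apply ⟨Γ y, hy⟩ (hH h hh) hk' e', H.tomita_apply y hh hk e, map_sub,
      LinearIsometryEquiv.map_smulₛₗ]
    simp
  obtain ⟨hx, hp⟩ := hxz
  obtain ⟨hx', ex⟩ := key ⟨x, hx⟩
  refine ⟨hx', fun y => ?_⟩
  obtain ⟨hy', ey⟩ := key y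
  have h1 := hp ⟨_, hy'⟩
  rw [ey] at h1
  have h2 := inner_conjugation Γ (Γ y) z
  have h3 := inner_conjugation Γ (Γ (H.tomita y)) (H.tomita ⟨x, hx⟩)
  rw [hΓ] at h2 h3
  rw [ex, h3, ← inner_conj_symm, h2, h1, inner_conj_symm]

end Conjugation

/-! ### The resolvent of `Δ_H` and the real-orthogonal geometry of `H`. -/

section Resolvent

variable [CompleteSpace 𝓗]

/-- If `k ∈ H` then `k - (1 + Δ_H)⁻¹ k` is symplectically orthogonal to `H`. -/
theorem inner_sub_modularResolvent_im (H : StandardSubspace 𝓗) {g k : 𝓗}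
    (hg : g ∈ H.toClosedSubmodule) (hk : k ∈ H.toClosedSubmodule) :
    ⟪g, k - H.modularResolvent k⟫.im = 0 := by
  obtain ⟨hx, hp⟩ := H.modularResolvent_spec k
  generalize H.modularResolvent k = x at hx hp ⊢
  obtain ⟨h, hh, l, hl, e⟩ := hx
  rw [H.tomita_apply _ hh hl e] at hp
  -- With `x = h + il`, the adjoint relation says that `(k - x) - S_H x = k - 2h` is real-orthogonal
  -- to `H`. This vector lies in `H` itself, so testing it against itself gives `k = 2h`, hence `k -
  -- x = S_H x`.
  have hm : k - h - h ∈ H.toClosedSubmodule :=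
    H.toClosedSubmodule.toSubmodule.sub_mem (H.toClosedSubmodule.toSubmodule.sub_mem hk hh) hh
  have h1 := hp ⟨_, H.mem_tomita_domain hm⟩
  rw [H.tomita_apply_of_mem hm, e] at h1
  have h2 : k - h - h = 0 := by
    have h3 := congrArg Complex.re h1
    rw [show ⟪k - h - h, h - Complex.I • l⟫.re = ⟪h - Complex.I • l, k - h - h⟫.re from
      inner_re_symm (𝕜 := ℂ) _ _, ← sub_eq_zero, ← Complex.sub_re, ← inner_sub_left] at h3
    have h4 : k - (h + Complex.I • l) - (h - Complex.I • l) = k - h - h := by abel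
    rw [h4] at h3
    exact (re_inner_self_nonpos (𝕜 := ℂ)).1 h3.le
  have h5 : k - x = h - Complex.I • l := by
    rw [e, ← sub_eq_zero, ← h2]; abel
  have h6 := hp ⟨g, H.mem_tomita_domain hg⟩
  rw [H.tomita_apply_of_mem hg, ← h5] at h6
  have h7 : ⟪g, k - x⟫.im = -⟪k - x, g⟫.im := inner_im_symm (𝕜 := ℂ) _ _
  rw [h6] at h7
  linarith

/-- For `k ∈ H`, the vector `i (2 (1 + Δ_H)⁻¹ - 1) k` is the real-orthogonal projection of `ik`
to `H`. -/
theorem re_inner_I_smul_eq (H : StandardSubspace 𝓗) {g k : 𝓗}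
    (hg : g ∈ H.toClosedSubmodule) (hk : k ∈ H.toClosedSubmodule) :
    ⟪g, Complex.I • k⟫.re =
      ⟪g, Complex.I • ((2 : ℂ) • H.modularResolvent k - k)⟫.re := by
  have h := H.inner_sub_modularResolvent_im hg hk
  rw [inner_sub_right, Complex.sub_im] at h
  simp only [inner_smul_right, inner_sub_right, Complex.mul_re, Complex.sub_re, Complex.sub_im,
    Complex.I_re, Complex.I_im, Complex.mul_im, Complex.re_ofNat, Complex.im_ofNat]
  linarith

/-- A standard subspace `K ⊆ H` that is invariant under `i (2 (1 + Δ_H)⁻¹ - 1)` is all of `H`. -/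
theorem eq_of_le_of_resolvent_mem {K H : StandardSubspace 𝓗}
    (hle : K.toClosedSubmodule ≤ H.toClosedSubmodule)
    (hT : ∀ k ∈ K.toClosedSubmodule,
      Complex.I • ((2 : ℂ) • H.modularResolvent k - k) ∈ K.toClosedSubmodule) : K = H := by
  refine StandardSubspace.ext (le_antisymm hle fun h hh => ?_)
  obtain ⟨p, hp, e⟩ := K.exists_real_projection h
  have hg : h - p ∈ H.toClosedSubmodule :=
    H.toClosedSubmodule.toSubmodule.sub_mem hh (hle hp)
  have h0 := K.eq_zero_of_re_inner_eq_zero e fun k hk => by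
    rw [H.re_inner_I_smul_eq hg (hle hk)]
    exact e _ (hT k hk)
  rw [sub_eq_zero.1 h0]
  exact hp

/-! ### Functional calculus under a conjugation. -/

section Conjugation

variable {H : StandardSubspace 𝓗} {Γ : 𝓗 ≃ₗᵢ⋆[ℂ] 𝓗}

theorem modularResolvent_conjugation (hΓ : IsConjugation Γ)
    (hH : ∀ h ∈ H.toClosedSubmodule, Γ h ∈ H.toClosedSubmodule) (u : 𝓗) :
    H.modularResolvent (Γ u) = Γ (H.modularResolvent u) := by
  refine (H.modularResolvent_spec _).eq_of_sub ?_
  rw [← map_sub]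
  exact (H.modularResolvent_spec u).conjugation hΓ hH

/-- Conjugation of bounded operators by a conjugation `Γ`. -/
noncomputable def conjugateHom (hΓ : IsConjugation Γ) : (𝓗 →L[ℂ] 𝓗) →⋆ₐ[ℝ] (𝓗 →L[ℂ] 𝓗) where
  toFun X := ((Γ : 𝓗 ≃L⋆[ℂ] 𝓗) : 𝓗 →L⋆[ℂ] 𝓗).comp (X.comp ((Γ : 𝓗 ≃L⋆[ℂ] 𝓗) : 𝓗 →L⋆[ℂ] 𝓗))
  map_one' := by ext x; simpa using hΓ x
  map_mul' X Y := by
    ext x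
    simp [hΓ (Y (Γ x))]
  map_zero' := by ext x; simp
  map_add' X Y := by ext x; simp
  commutes' r := by
    ext x
    have h : Γ (r • Γ x) = r • x := by
      rw [← Complex.coe_smul, LinearIsometryEquiv.map_smulₛₗ, Complex.conj_ofReal, hΓ,
        Complex.coe_smul]
    simpa [Algebra.algebraMap_eq_smul_one] using h
  map_star' X := by
    rw [ContinuousLinearMap.star_eq_adjoint, ContinuousLinearMap.star_eq_adjoint,
      ContinuousLinearMap.eq_adjoint_iff]
    intro x y
    have h1 := inner_conjugation Γ (X.adjoint (Γ x)) (Γ y)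
    have h2 := inner_conjugation Γ (Γ x) (X (Γ y))
    rw [hΓ] at h1 h2
    simp [h1, h2, ContinuousLinearMap.adjoint_inner_right]

theorem conjugateHom_apply (hΓ : IsConjugation Γ) (X : 𝓗 →L[ℂ] 𝓗) (x : 𝓗) :
    conjugateHom hΓ X x = Γ (X (Γ x)) := rfl

theorem continuous_conjugateHom (hΓ : IsConjugation Γ) :
    Continuous (conjugateHom hΓ : (𝓗 →L[ℂ] 𝓗) → 𝓗 →L[ℂ] 𝓗) := by
  refine AddMonoidHomClass.continuous_of_bound (conjugateHom hΓ) 1 fun X => ?_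
  refine ContinuousLinearMap.opNorm_le_bound _ (by positivity) fun x => ?_
  rw [conjugateHom_apply, Γ.norm_map, one_mul]
  exact (X.le_opNorm _).trans_eq (by rw [Γ.norm_map])

theorem conjugateHom_modularResolvent (hΓ : IsConjugation Γ)
    (hH : ∀ h ∈ H.toClosedSubmodule, Γ h ∈ H.toClosedSubmodule) :
    conjugateHom hΓ H.modularResolvent = H.modularResolvent := by
  ext x
  rw [conjugateHom_apply, modularResolvent_conjugation hΓ hH, hΓ]

theorem conjugateHom_I_smul (hΓ : IsConjugation Γ) (X : 𝓗 →L[ℂ] 𝓗) :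
    conjugateHom hΓ (Complex.I • X) = -(Complex.I • conjugateHom hΓ X) := by
  ext x
  simp [conjugateHom_apply, LinearIsometryEquiv.map_smulₛₗ]

/-- Conjugation by `Γ` is a homomorphism over `ℝ` only, so it commutes with the real functional
calculus of `A`. Splitting `f` into real and imaginary parts reduces to that case, the factor `i`
changing sign. -/
theorem conjugateHom_cfc (hΓ : IsConjugation Γ) {A : 𝓗 →L[ℂ] 𝓗} (hA : IsSelfAdjoint A)
    (hΓA : conjugateHom hΓ A = A) {f : ℂ → ℂ} (hf : ContinuousOn f (spectrum ℂ A)) :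
    conjugateHom hΓ (cfc f A) = cfc (fun z => starRingEnd ℂ (f z)) A := by
  have hN := hA.isStarNormal
  have hmap : ∀ g : ℝ → ℝ, ContinuousOn g (spectrum ℝ A) →
      conjugateHom hΓ (cfc g A) = cfc g A := fun g hg => by
    rw [StarAlgHomClass.map_cfc (conjugateHom hΓ) g A hg (continuous_conjugateHom hΓ) hA
      (by rwa [hΓA]), hΓA]
  have hr : ContinuousOn (fun a : ℝ => f a) (spectrum ℝ A) :=
    hf.comp Complex.continuous_ofReal.continuousOn fun a ha => spectrum.algebraMap_mem ℂ ha
  have h1 : ContinuousOn (fun a : ℝ => (f a).re) (spectrum ℝ A) :=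
    Complex.continuous_re.comp_continuousOn hr
  have h2 : ContinuousOn (fun a : ℝ => (f a).im) (spectrum ℝ A) :=
    Complex.continuous_im.comp_continuousOn hr
  -- The complex form of a real functional calculus evaluates at `z.re`, which agrees with `z` on
  -- the spectrum of a self-adjoint operator.
  have e : ∀ z ∈ spectrum ℂ A, ((z.re : ℝ) : ℂ) = z := fun z hz =>
    (hA.mem_spectrum_eq_re hz).symm
  have c1 : ContinuousOn (fun z : ℂ => ((f z.re).re : ℂ)) (spectrum ℂ A) :=
    (Complex.continuous_ofReal.comp Complex.continuous_re).comp_continuousOn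
      (hf.congr fun z hz => by rw [e z hz])
  have c2 : ContinuousOn (fun z : ℂ => ((f z.re).im : ℂ)) (spectrum ℂ A) :=
    (Complex.continuous_ofReal.comp Complex.continuous_im).comp_continuousOn
      (hf.congr fun z hz => by rw [e z hz])
  have s1 : cfc f A = cfc (fun a : ℝ => (f a).re) A +
      Complex.I • cfc (fun a : ℝ => (f a).im) A := by
    have c3 : ContinuousOn (fun z : ℂ => Complex.I • ((f z.re).im : ℂ)) (spectrum ℂ A) :=
      ContinuousOn.fun_const_smul c2 _
    rw [cfc_real_eq_complex, cfc_real_eq_complex, ← cfc_smul _ _ _ c2, ← cfc_add _ _ _ c1 c3]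
    refine cfc_congr fun z hz => ?_
    simp only [e z hz, smul_eq_mul]
    rw [mul_comm, Complex.re_add_im]
  have s2 : cfc (fun z => starRingEnd ℂ (f z)) A = cfc (fun a : ℝ => (f a).re) A +
      (-Complex.I) • cfc (fun a : ℝ => (f a).im) A := by
    have c3 : ContinuousOn (fun z : ℂ => (-Complex.I) • ((f z.re).im : ℂ)) (spectrum ℂ A) :=
      ContinuousOn.fun_const_smul c2 _
    rw [cfc_real_eq_complex, cfc_real_eq_complex, ← cfc_smul _ _ _ c2, ← cfc_add _ _ _ c1 c3]
    refine cfc_congr fun z hz => ?_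
    simp only [e z hz, smul_eq_mul]
    apply Complex.ext <;> simp
  rw [s1, s2, map_add, conjugateHom_I_smul, hmap _ h1, hmap _ h2, neg_smul]

theorem conj_regImagPowAux (t ε : ℝ) {a : ℝ} (ha : a ∈ Set.Icc (0 : ℝ) 1) :
    starRingEnd ℂ (regImagPowAux t ε a) = regImagPowAux (-t) ε a := by
  rw [regImagPowAux_eq t ε ha, regImagPowAux_eq (-t) ε ha, map_mul, Complex.conj_ofReal]
  congr 1
  have h0 : (0 : ℝ) ≤ (1 - a) / a := div_nonneg (by linarith [ha.2]) ha.1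
  -- The branch cut is avoided because the base is nonnegative; this includes `a = 0`, where the
  -- quotient is `0` by convention.
  have h := Complex.cpow_conj (((1 - a) / a : ℝ) : ℂ) (t * Complex.I)
    (by rw [Complex.arg_ofReal_of_nonneg h0]; exact Real.pi_pos.ne)
  rw [Complex.conj_ofReal] at h
  rw [← h]
  simp

/-- The identity holds for each regularized operator, since conjugating the symbol changes `t` to
`-t`; it passes to the strong limit by continuity of `Γ`. -/
theorem modularUnitary_neg_conjugation (hΓ : IsConjugation Γ)
    (hH : ∀ h ∈ H.toClosedSubmodule, Γ h ∈ H.toClosedSubmodule) (t : ℝ) (x : 𝓗) :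
    H.modularUnitary (-t) x = Γ (H.modularUnitary t (Γ x)) := by
  refine tendsto_nhds_unique (H.tendsto_modularUnitary (-t) x) ?_
  refine ((Γ.continuous.tendsto _).comp (H.tendsto_modularUnitary t (Γ x))).congr' ?_
  filter_upwards [self_mem_nhdsWithin] with ε hε
  have h := conjugateHom_cfc hΓ H.isSelfAdjoint_modularResolvent
    (conjugateHom_modularResolvent hΓ hH) (H.continuousOn_regImagPowAux_spectrum t hε)
  have h' := DFunLike.congr_fun h x
  rw [conjugateHom_apply] at h'
  refine h'.trans ?_
  congr 1
  refine cfc_congr fun z hz => ?_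
  obtain ⟨a, ha, rfl⟩ := H.spectrum_modularResolvent hz
  exact conj_regImagPowAux t ε ha

end Conjugation

end Resolvent

/-! ### Weighted approximation of `-i tanh(l / 2)` by real trigonometric polynomials. -/

section Trigonometric

/-- The character `l ↦ e^{itl}` of the real line. -/
noncomputable def trigChar (t : ℝ) : ℝ → ℂ := fun l => Complex.exp (t * l * Complex.I)

/-- Trigonometric polynomials with real coefficients and arbitrary real frequencies. -/
noncomputable def realTrig : Submodule ℝ (ℝ → ℂ) := Submodule.span ℝ (Set.range trigChar)

/-- The characters of the real line as a submonoid of the algebra of functions. -/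
noncomputable def trigCharSubmonoid : Submonoid (ℝ → ℂ) where
  carrier := Set.range trigChar
  one_mem' := ⟨0, by ext; simp [trigChar]⟩
  mul_mem' := by
    rintro _ _ ⟨s, rfl⟩ ⟨t, rfl⟩
    refine ⟨s + t, ?_⟩
    ext l
    simp only [trigChar, Pi.mul_apply, ← Complex.exp_add]
    congr 1
    push_cast
    ring

/-- Characters are closed under products, so their linear span is already an algebra. This makes
polynomials in `sin (l / R)` trigonometric polynomials. -/
theorem adjoin_trigChar :
    Subalgebra.toSubmodule (Algebra.adjoin ℂ (Set.range trigChar)) =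
      Submodule.span ℂ (Set.range trigChar) := by
  rw [Algebra.adjoin_eq_span]
  congr 1
  exact congrArg SetLike.coe (Submonoid.closure_eq trigCharSubmonoid)

theorem polynomial_sin_mem_span (p : Polynomial ℝ) (R : ℝ) :
    (fun l : ℝ => Complex.I * ((p.eval (Real.sin (l / R)) : ℝ) : ℂ)) ∈
      Submodule.span ℂ (Set.range trigChar) := by
  rw [← adjoin_trigChar, Subalgebra.mem_toSubmodule]
  set S := Algebra.adjoin ℂ (Set.range trigChar)
  have hS : ∀ t, trigChar t ∈ S := fun t => Algebra.subset_adjoin ⟨t, rfl⟩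
  have hsin : (fun l : ℝ => ((Real.sin (l / R) : ℝ) : ℂ)) ∈ S := by
    have e : (fun l : ℝ => ((Real.sin (l / R) : ℝ) : ℂ)) =
        (Complex.I / 2) • (trigChar (-(1 / R)) - trigChar (1 / R)) := by
      ext l
      simp only [trigChar, Pi.smul_apply, Pi.sub_apply, smul_eq_mul, Complex.ofReal_sin,
        Complex.sin]
      have e1 : -((l / R : ℝ) : ℂ) * Complex.I = ((-(1 / R) : ℝ) : ℂ) * l * Complex.I := by
        push_cast; ring
      have e2 : ((l / R : ℝ) : ℂ) * Complex.I = ((1 / R : ℝ) : ℂ) * l * Complex.I := by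
        push_cast; ring
      rw [e1, e2]
      ring
    rw [e]
    exact S.smul_mem (S.sub_mem (hS _) (hS _)) _
  have hp : (fun l : ℝ => ((p.eval (Real.sin (l / R)) : ℝ) : ℂ)) ∈ S := by
    induction p using Polynomial.induction_on' with
    | add p q hp hq =>
      convert S.add_mem hp hq using 1
      ext l
      simp
    | monomial n a =>
      convert S.smul_mem (S.pow_mem hsin n) (a : ℂ) using 1
      ext l
      simp
  exact S.smul_mem hp Complex.I

/-- Symmetrizing a trigonometric polynomial makes its coefficients real. -/
theorem symmetrization_mem_realTrig {f : ℝ → ℂ} (hf : f ∈ Submodule.span ℂ (Set.range trigChar)) :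
    (fun l => (f l + starRingEnd ℂ (f (-l))) / 2) ∈ realTrig := by
  -- Symmetrization is only real-linear; quantifying over `c` lets the induction pass through
  -- complex scalars. On `c • trigChar t` it yields the real coefficient `c.re`.
  suffices h : ∀ c : ℂ, (fun l => (c * f l + starRingEnd ℂ (c * f (-l))) / 2) ∈ realTrig by
    simpa using h 1
  induction hf using Submodule.span_induction with
  | mem x hx =>
    obtain ⟨t, rfl⟩ := hx
    intro c
    convert realTrig.smul_mem c.re (Submodule.subset_span ⟨t, rfl⟩ : trigChar t ∈ realTrig) using 1
    ext l
    have e : starRingEnd ℂ (trigChar t (-l)) = trigChar t l := by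
      simp only [trigChar, ← Complex.exp_conj]
      simp
    rw [map_mul, e, ← add_mul, Complex.add_conj, Pi.smul_apply, Complex.real_smul]
    push_cast
    ring
  | zero =>
    intro c
    convert realTrig.zero_mem using 1
    ext l
    simp
  | add x y _ _ hx hy =>
    intro c
    convert realTrig.add_mem (hx c) (hy c) using 1
    ext l
    simp only [Pi.add_apply, map_add, mul_add]
    ring
  | smul d x _ hx =>
    intro c
    convert hx (c * d) using 1
    ext l
    simp only [Pi.smul_apply, smul_eq_mul, mul_assoc]

/-- The function `l ↦ (1 - e^l) / (1 + e^l) = -tanh (l / 2)`. -/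
noncomputable def negTanhHalf (l : ℝ) : ℝ := 2 / (1 + Real.exp l) - 1

theorem negTanhHalf_neg (l : ℝ) : negTanhHalf (-l) = -negTanhHalf l := by
  have := Real.exp_pos l
  rw [negTanhHalf, negTanhHalf, Real.exp_neg]
  field_simp
  ring

theorem abs_negTanhHalf_le (l : ℝ) : |negTanhHalf l| ≤ 1 := by
  have := Real.exp_pos l
  rw [negTanhHalf, abs_le]
  have h1 : 0 ≤ 2 / (1 + Real.exp l) := by positivity
  have h2 : 2 / (1 + Real.exp l) ≤ 2 := by
    rw [div_le_iff₀ (by positivity)]; linarith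
  constructor <;> linarith

theorem continuous_negTanhHalf : Continuous negTanhHalf := by
  refine (continuous_const.div (by fun_prop) fun l => ?_).sub continuous_const
  have := Real.exp_pos l
  positivity

theorem abs_negTanhHalf_sub_le (x y : ℝ) : |negTanhHalf x - negTanhHalf y| ≤ 2 * |x - y| := by
  wlog hxy : x ≤ y generalizing x y
  · rw [abs_sub_comm, abs_sub_comm x]
    exact this y x (le_of_not_ge hxy)
  have hx := Real.exp_pos x
  have hy := Real.exp_pos y
  have h1 : Real.exp y - Real.exp x ≤ Real.exp y * (y - x) := by
    have := Real.add_one_le_exp (x - y)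
    rw [Real.exp_sub, le_div_iff₀ hy] at this
    linarith
  have e : negTanhHalf x - negTanhHalf y =
      2 * ((Real.exp y - Real.exp x) / ((1 + Real.exp x) * (1 + Real.exp y))) := by
    rw [negTanhHalf, negTanhHalf]
    field_simp
    ring
  have h2 : 0 ≤ Real.exp y - Real.exp x := sub_nonneg.2 (Real.exp_le_exp.2 hxy)
  rw [e, abs_of_nonneg (by positivity), abs_sub_comm x, abs_of_nonneg (sub_nonneg.2 hxy)]
  gcongr
  rw [div_le_iff₀ (by positivity)]
  nlinarith [sub_nonneg.2 hxy, mul_nonneg (sub_nonneg.2 hxy) hx.le,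
    mul_nonneg (mul_nonneg (sub_nonneg.2 hxy) hx.le) hy.le]

/-- A crude quadratic bound valid on the whole line is wanted, since `log_sq_mul_le` controls
exactly the square of `l`. It comes from Taylor's bound for `|x| ≤ 1` and from `|sin x| ≤ 1`
otherwise. -/
theorem abs_sin_sub_self_le (x : ℝ) : |Real.sin x - x| ≤ 2 * x ^ 2 := by
  rcases le_total |x| 1 with h | h
  · have h1 := Real.sin_bound h
    have h2 : |x| ^ 5 ≤ x ^ 2 := by
      rw [← sq_abs x]
      exact pow_le_pow_of_le_one (abs_nonneg x) h (by norm_num)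
    have h4 : |x ^ 3 / 6| ≤ x ^ 2 := by
      rw [abs_div, abs_pow, ← sq_abs x, abs_of_pos (by norm_num : (0 : ℝ) < 6)]
      nlinarith [abs_nonneg x, pow_nonneg (abs_nonneg x) 2]
    have h5 : Real.sin x - x = (Real.sin x - (x - x ^ 3 / 6)) - x ^ 3 / 6 := by ring
    rw [h5]
    refine (abs_sub _ _).trans ?_
    linarith [sq_nonneg x]
  · have h1 := (abs_sub (Real.sin x) x)
    have h2 := Real.abs_sin_le_one x
    rw [← sq_abs]
    nlinarith

theorem two_add_sq_div_two_le_exp_add_exp_neg (x : ℝ) :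
    2 + x ^ 2 / 2 ≤ Real.exp x + Real.exp (-x) := by
  wlog hx : 0 ≤ x generalizing x
  · have := this (-x) (by linarith)
    rw [neg_neg, neg_sq] at this
    linarith
  linarith [Real.quadratic_le_exp_of_nonneg hx, Real.add_one_le_exp (-x)]

/-- With `l = log((1 - a) / a)` one has `e^l + e^{-l} = 1 / (a(1 - a)) - 2`, which dominates `2 + l²
/ 2`. -/
theorem log_sq_mul_le {a : ℝ} (h0 : 0 < a) (h1 : 0 < 1 - a) :
    Real.log ((1 - a) / a) ^ 2 * (a * (1 - a)) ≤ 2 := by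
  have h2 := two_add_sq_div_two_le_exp_add_exp_neg (Real.log ((1 - a) / a))
  rw [Real.exp_neg, Real.exp_log (by positivity), inv_div] at h2
  have h3 : (1 - a) / a + a / (1 - a) = ((1 - a) ^ 2 + a ^ 2) / (a * (1 - a)) := by
    field_simp
  rw [h3, le_div_iff₀ (by positivity)] at h2
  nlinarith [mul_pos h0 h1]

theorem negTanhHalf_log {a : ℝ} (h0 : 0 < a) (h1 : a < 1) :
    negTanhHalf (Real.log ((1 - a) / a)) = 2 * a - 1 := by
  have : 0 < 1 - a := sub_pos.2 h1
  rw [negTanhHalf, Real.exp_log (by positivity)]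
  field_simp
  ring

/-- Replace `l` by the periodic function `R sin(l / R)`, which is close to `l` when `R` is large
compared with `l²`, and approximate `s ↦ negTanhHalf (R s)` on `[-1, 1]` by a polynomial
(Weierstrass). The weight `a(1 - a)` absorbs the growth of the error at large `|l|`. -/
theorem exists_realTrig_near {δ : ℝ} (hδ : 0 < δ) :
    ∃ q ∈ realTrig, (∀ l, ‖q l‖ ≤ 2) ∧ ∀ a ∈ Set.Icc (0 : ℝ) 1,
      ‖q (Real.log ((1 - a) / a)) - Complex.I * (2 * a - 1)‖ * (a * (1 - a)) ≤ δ := by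
  -- The substitution costs at most `4 l² / R`, which the weight reduces to `8 / R = δ / 2`. The
  -- polynomial contributes the other `δ / 2`; its error is also kept below `1` so that `‖q‖ ≤ 1 +
  -- 1`.
  set R : ℝ := 16 / δ with hR
  have hR0 : 0 < R := by positivity
  obtain ⟨p, hp⟩ := exists_polynomial_near_of_continuousOn (-1) 1 (fun s => negTanhHalf (R * s))
    (continuous_negTanhHalf.comp (by fun_prop)).continuousOn (min (δ / 2) 1) (by positivity)
  set f : ℝ → ℂ := fun l => Complex.I * ((p.eval (Real.sin (l / R)) : ℝ) : ℂ) with hf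
  set q : ℝ → ℂ := fun l => (f l + starRingEnd ℂ (f (-l))) / 2 with hq
  -- Symmetrization does not spoil the approximation, because the target is `i` times an odd real
  -- function and is its own symmetrization.
  have hnear : ∀ l, ‖q l - Complex.I * (negTanhHalf (R * Real.sin (l / R)) : ℝ)‖ ≤
      min (δ / 2) 1 := by
    intro l
    have h1 := (hp (Real.sin (l / R)) ⟨Real.neg_one_le_sin _, Real.sin_le_one _⟩).le
    have h2 := (hp (Real.sin (-l / R)) ⟨Real.neg_one_le_sin _, Real.sin_le_one _⟩).le
    rw [neg_div, Real.sin_neg, mul_neg, negTanhHalf_neg] at h2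
    set u := negTanhHalf (R * Real.sin (l / R))
    have e : q l - Complex.I * (u : ℝ) = Complex.I *
        ((((p.eval (Real.sin (l / R)) - u) - (p.eval (-Real.sin (l / R)) - -u)) / 2 : ℝ) : ℂ) := by
      simp only [hq, hf, map_mul, Complex.conj_I, Complex.conj_ofReal, neg_div, Real.sin_neg]
      push_cast
      ring
    rw [e, norm_mul, Complex.norm_I, one_mul, Complex.norm_real, Real.norm_eq_abs, abs_div,
      abs_of_pos (two_pos : (0 : ℝ) < 2)]
    have := abs_sub (p.eval (Real.sin (l / R)) - u) (p.eval (-Real.sin (l / R)) - -u)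
    linarith
  refine ⟨q, symmetrization_mem_realTrig (polynomial_sin_mem_span p R), fun l => ?_,
    fun a ha => ?_⟩
  · have h1 := (hnear l).trans (min_le_right _ _)
    have h2 : ‖Complex.I * (negTanhHalf (R * Real.sin (l / R)) : ℝ)‖ ≤ 1 := by
      rw [norm_mul, Complex.norm_I, one_mul, Complex.norm_real]
      exact abs_negTanhHalf_le _
    linarith [norm_sub_norm_le (q l) (Complex.I * (negTanhHalf (R * Real.sin (l / R)) : ℝ))]
  · have hs : 0 ≤ a * (1 - a) := mul_nonneg ha.1 (sub_nonneg.2 ha.2)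
    rcases hs.eq_or_lt with h0 | h0
    · rw [← h0, mul_zero]; exact hδ.le
    have ha0 : 0 < a := lt_of_le_of_ne ha.1 (by rintro rfl; simp at h0)
    have ha1 : 0 < 1 - a := pos_of_mul_pos_right h0 ha.1
    have h3 := log_sq_mul_le ha0 ha1
    have h5 := negTanhHalf_log ha0 (sub_pos.1 ha1)
    set l := Real.log ((1 - a) / a)
    have h1 := (hnear l).trans (min_le_left _ _)
    have h2 : ‖Complex.I * (negTanhHalf (R * Real.sin (l / R)) : ℝ) - Complex.I * (2 * a - 1)‖ ≤
        4 * l ^ 2 / R := by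
      have e : Complex.I * (negTanhHalf (R * Real.sin (l / R)) : ℝ) - Complex.I * (2 * a - 1) =
          Complex.I * ((negTanhHalf (R * Real.sin (l / R)) - negTanhHalf l : ℝ) : ℂ) := by
        rw [h5]; push_cast; ring
      rw [e, norm_mul, Complex.norm_I, one_mul, Complex.norm_real]
      refine (abs_negTanhHalf_sub_le _ _).trans ?_
      have e2 : R * Real.sin (l / R) - l = R * (Real.sin (l / R) - l / R) := by
        field_simp
      rw [e2, abs_mul, abs_of_pos hR0]
      calc 2 * (R * |Real.sin (l / R) - l / R|) ≤ 2 * (R * (2 * (l / R) ^ 2)) := by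
            gcongr; exact abs_sin_sub_self_le _
        _ = 4 * l ^ 2 / R := by field_simp; ring
    have h4 := norm_sub_le_norm_sub_add_norm_sub (q l)
      (Complex.I * (negTanhHalf (R * Real.sin (l / R)) : ℝ)) (Complex.I * (2 * a - 1))
    calc ‖q l - Complex.I * (2 * a - 1)‖ * (a * (1 - a))
        ≤ (δ / 2 + 4 * l ^ 2 / R) * (a * (1 - a)) := by gcongr; linarith
      _ = δ / 2 * (a * (1 - a)) + 4 / R * (l ^ 2 * (a * (1 - a))) := by ring
      _ ≤ δ / 2 * 1 + 4 / R * 2 := by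
          gcongr
          nlinarith [ha.1, ha.2]
      _ = δ := by rw [hR]; field_simp; norm_num

end Trigonometric

/-! ### Invariance under the modular group implies invariance under `T`. -/

section Limit

variable [CompleteSpace 𝓗]

/-- The function `q(log s) (s / (1 + s)²)^ε` of `s`, in the variable `z = 1 / (1 + s)`. -/
noncomputable def trigReg (q : ℝ → ℂ) (ε : ℝ) (z : ℂ) : ℂ :=
  q (Real.log ((1 - z.re) / z.re)) * (((z.re * (1 - z.re)) ^ ε : ℝ) : ℂ)

theorem trigReg_trigChar (t : ℝ) {ε : ℝ} (hε : 0 < ε) {a : ℝ} (ha : a ∈ Set.Icc (0 : ℝ) 1) :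
    trigReg (trigChar t) ε a = regImagPowAux t ε a := by
  rw [regImagPowAux_eq t ε ha, trigReg, Complex.ofReal_re]
  rcases (mul_nonneg ha.1 (sub_nonneg.2 ha.2) : 0 ≤ a * (1 - a)).eq_or_lt with h0 | h0
  · rw [← h0, Real.zero_rpow hε.ne']
    simp
  have ha0 : 0 < a := lt_of_le_of_ne ha.1 (by rintro rfl; simp at h0)
  have ha1 : 0 < 1 - a := pos_of_mul_pos_right h0 ha.1
  have hpos : 0 < (1 - a) / a := by positivity
  congr 1
  rw [trigChar, Complex.cpow_def_of_ne_zero (by exact_mod_cast hpos.ne'),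
    ← Complex.ofReal_log hpos.le]
  congr 1
  ring

/-- For a character the limit is `Δ_H^{it} k`, and real combinations stay in `K`. Continuity is
carried through the same induction because additivity and homogeneity of `cfc` need it. -/
theorem trigReg_spec {K H : StandardSubspace 𝓗}
    (hU : ∀ t, ∀ k ∈ K.toClosedSubmodule, H.modularUnitary t k ∈ K.toClosedSubmodule)
    {q : ℝ → ℂ} (hq : q ∈ realTrig) :
    (∀ ε, 0 < ε → ContinuousOn (trigReg q ε) (spectrum ℂ H.modularResolvent)) ∧
    ∀ k ∈ K.toClosedSubmodule, ∃ y ∈ K.toClosedSubmodule,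
      Tendsto (fun ε : ℝ => cfc (trigReg q ε) H.modularResolvent k) (𝓝[>] 0) (𝓝 y) := by
  induction hq using Submodule.span_induction with
  | mem x hx =>
    obtain ⟨t, rfl⟩ := hx
    have e : ∀ ε, 0 < ε → Set.EqOn (trigReg (trigChar t) ε) (regImagPowAux t ε)
        (spectrum ℂ H.modularResolvent) := fun ε hε z hz => by
      obtain ⟨a, ha, rfl⟩ := H.spectrum_modularResolvent hz
      exact trigReg_trigChar t hε ha
    refine ⟨fun ε hε => (H.continuousOn_regImagPowAux_spectrum t hε).congr (e ε hε),
      fun k hk => ⟨_, hU t k hk, (H.tendsto_modularUnitary t k).congr' ?_⟩⟩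
    filter_upwards [self_mem_nhdsWithin] with ε hε
    exact congrArg (fun X : 𝓗 →L[ℂ] 𝓗 => X k) (cfc_congr (e ε hε)).symm
  | zero =>
    have e : ∀ ε, trigReg 0 ε = fun _ => 0 := fun ε => by ext; simp [trigReg]
    simp only [e]
    exact ⟨fun _ _ => continuousOn_const, fun k hk => ⟨0, zero_mem _, by simp⟩⟩
  | add x y _ _ hx hy =>
    have e : ∀ ε, trigReg (x + y) ε = fun z => trigReg x ε z + trigReg y ε z :=
      fun ε => by ext; simp [trigReg, add_mul]
    simp only [e]
    refine ⟨fun ε hε => (hx.1 ε hε).add (hy.1 ε hε), fun k hk => ?_⟩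
    obtain ⟨u, hu, hu'⟩ := hx.2 k hk
    obtain ⟨v, hv, hv'⟩ := hy.2 k hk
    refine ⟨u + v, add_mem hu hv, (hu'.add hv').congr' ?_⟩
    filter_upwards [self_mem_nhdsWithin] with ε hε
    rw [cfc_add _ _ _ (hx.1 ε hε) (hy.1 ε hε)]
    rfl
  | smul c x _ hx =>
    have e : ∀ ε, trigReg (c • x) ε = fun z => (c : ℂ) • trigReg x ε z :=
      fun ε => by ext; simp [trigReg, mul_assoc]
    simp only [e]
    refine ⟨fun ε hε => ContinuousOn.fun_const_smul (hx.1 ε hε) _, fun k hk => ?_⟩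
    obtain ⟨u, hu, hu'⟩ := hx.2 k hk
    refine ⟨c • u, SMulMemClass.smul_mem _ hu, (hu'.const_smul c).congr' ?_⟩
    filter_upwards [self_mem_nhdsWithin] with ε hε
    rw [cfc_smul _ _ _ (hx.1 ε hε)]
    exact (Complex.coe_smul _ _).symm

theorem mul_one_sub_rpow_le {ε : ℝ} (hε : 0 < ε) {a : ℝ} (ha : a ∈ Set.Icc (0 : ℝ) 1) :
    ‖(((a * (1 - a)) ^ ε : ℝ) : ℂ) - 1‖ * (a * (1 - a)) ≤ ε := by
  have h := norm_regImagPowAux_sub_le 0 hε ha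
  have hs : 0 ≤ a * (1 - a) := mul_nonneg ha.1 (sub_nonneg.2 ha.2)
  rw [regImagPowAux_eq 0 ε ha, regImagPowAux_eq 0 1 ha, Real.rpow_one] at h
  refine le_trans (le_of_eq ?_) h
  generalize (a * (1 - a)) ^ ε = r
  conv_lhs => rw [← abs_of_nonneg hs, ← Real.norm_eq_abs, ← Complex.norm_real, ← norm_mul]
  rw [Complex.ofReal_zero, zero_mul, Complex.cpow_zero]
  congr 1
  push_cast
  ring

/-- The error splits into the effect of the regularizing factor, at most `2ε` since `‖q‖ ≤ 2`, and
the weighted error `δ` of `q`. -/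
theorem norm_trigReg_sub_mul_le {q : ℝ → ℂ} (hq : ∀ l, ‖q l‖ ≤ 2) {δ : ℝ}
    {a : ℝ} (ha : a ∈ Set.Icc (0 : ℝ) 1)
    (hqδ : ‖q (Real.log ((1 - a) / a)) - Complex.I * (2 * a - 1)‖ * (a * (1 - a)) ≤ δ)
    {ε : ℝ} (hε : 0 < ε) :
    ‖(trigReg q ε a - Complex.I * (2 * a - 1)) * (a * (1 - a))‖ ≤ 2 * ε + δ := by
  have hs : 0 ≤ a * (1 - a) := mul_nonneg ha.1 (sub_nonneg.2 ha.2)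
  have h1 := mul_one_sub_rpow_le hε ha
  rw [trigReg, Complex.ofReal_re]
  have h2 := hq (Real.log ((1 - a) / a))
  set u := q (Real.log ((1 - a) / a))
  set r : ℂ := (((a * (1 - a)) ^ ε : ℝ) : ℂ)
  have e : ‖(a : ℂ) * (1 - a)‖ = a * (1 - a) := by
    rw [← abs_of_nonneg hs, ← Real.norm_eq_abs, ← Complex.norm_real]
    push_cast
    rfl
  rw [norm_mul, e]
  calc ‖u * r - Complex.I * (2 * a - 1)‖ * (a * (1 - a))
      = ‖u * (r - 1) + (u - Complex.I * (2 * a - 1))‖ * (a * (1 - a)) := by congr 2; ring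
    _ ≤ (‖u * (r - 1)‖ + ‖u - Complex.I * (2 * a - 1)‖) * (a * (1 - a)) := by
        gcongr; exact norm_add_le _ _
    _ = ‖u‖ * (‖r - 1‖ * (a * (1 - a))) + ‖u - Complex.I * (2 * a - 1)‖ * (a * (1 - a)) := by
        rw [norm_mul]; ring
    _ ≤ 2 * ε + δ := by gcongr

theorem norm_trigReg_le {q : ℝ → ℂ} (hq : ∀ l, ‖q l‖ ≤ 2) {ε : ℝ} (hε : 0 < ε) {a : ℝ}
    (ha : a ∈ Set.Icc (0 : ℝ) 1) : ‖trigReg q ε a‖ ≤ 2 := by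
  have hs : 0 ≤ a * (1 - a) := mul_nonneg ha.1 (sub_nonneg.2 ha.2)
  rw [trigReg, Complex.ofReal_re, norm_mul, Complex.norm_real, Real.norm_eq_abs,
    abs_of_nonneg (Real.rpow_nonneg hs _)]
  have h1 : (a * (1 - a)) ^ ε ≤ 1 := Real.rpow_le_one hs (by nlinarith [ha.1, ha.2]) hε.le
  calc _ ≤ (2 : ℝ) * 1 := by gcongr; exact hq _
    _ = 2 := mul_one _

/-- A closed real subspace that is invariant under the modular group of `H` is invariant under
`i (2 (1 + Δ_H)⁻¹ - 1) = -i tanh (log Δ_H / 2)`. -/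
theorem resolvent_mem_of_modularUnitary_mem {K H : StandardSubspace 𝓗}
    (hU : ∀ t, ∀ k ∈ K.toClosedSubmodule, H.modularUnitary t k ∈ K.toClosedSubmodule)
    {k : 𝓗} (hk : k ∈ K.toClosedSubmodule) :
    Complex.I • ((2 : ℂ) • H.modularResolvent k - k) ∈ K.toClosedSubmodule := by
  have hN : IsStarNormal H.modularResolvent := H.isSelfAdjoint_modularResolvent.isStarNormal
  set A := H.modularResolvent with hA
  set T := cfc (fun z : ℂ => Complex.I * (2 * z - 1)) A with hT
  have cT : ContinuousOn (fun z : ℂ => Complex.I * (2 * z - 1)) (spectrum ℂ A) := by fun_prop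
  have cB : ContinuousOn (fun z : ℂ => z * (1 - z)) (spectrum ℂ A) := by fun_prop
  have eT : T = Complex.I • ((2 : ℂ) • A - 1) := by
    rw [hT, cfc_const_mul Complex.I (fun z : ℂ => 2 * z - 1), cfc_sub (fun z : ℂ => 2 * z)
      (fun _ : ℂ => 1), cfc_const_mul (2 : ℂ) (fun z : ℂ => z), cfc_id' ℂ A, cfc_const_one ℂ A]
  have eB : cfc (fun z : ℂ => z * (1 - z)) A = A * (1 - A) := by
    rw [cfc_mul (fun a : ℂ => a) (fun a : ℂ => 1 - a), cfc_sub (fun _ : ℂ => 1) (fun a : ℂ => a),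
      cfc_id' ℂ A, cfc_const_one ℂ A]
  have nT : ‖T‖ ≤ 1 := by
    refine norm_cfc_le zero_le_one fun z hz => ?_
    obtain ⟨a, ha, rfl⟩ := H.spectrum_modularResolvent hz
    have e : Complex.I * (2 * (a : ℂ) - 1) = Complex.I * ((2 * a - 1 : ℝ) : ℂ) := by push_cast; rfl
    rw [e, norm_mul, Complex.norm_I, one_mul, Complex.norm_real, Real.norm_eq_abs, abs_le]
    constructor <;> linarith [ha.1, ha.2]
  have goal_eq : Complex.I • ((2 : ℂ) • A k - k) = T k := by rw [eT]; simp
  rw [goal_eq]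
  refine K.toClosedSubmodule.isClosed.closure_subset (Metric.mem_closure_iff.2 fun η hη => ?_)
  obtain ⟨w, hw⟩ := H.dense_range_modular.exists_dist_lt k (show 0 < η / 8 by positivity)
  -- The weighted estimate controls operators on the range of `A(1 - A)`, which is dense, so `k` is
  -- replaced by a nearby `b` there.
  set b := A (w - A w) with hb
  have eb : b = cfc (fun z : ℂ => z * (1 - z)) A w := by rw [eB]; simp [hb]
  rw [dist_eq_norm] at hw
  -- This makes `δ‖w‖ ≤ η / 8`; the `+ 1` covers `w = 0`.
  set δ := η / (8 * (‖w‖ + 1)) with hδ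
  obtain ⟨q, hq, hq2, hqδ⟩ := exists_realTrig_near (show 0 < δ by positivity)
  obtain ⟨hc, hlim⟩ := trigReg_spec hU hq
  obtain ⟨y, hy, hty⟩ := hlim k hk
  refine ⟨y, hy, ?_⟩
  -- On `k - b` the bounds `‖T‖ ≤ 1` and `‖G‖ ≤ 2`, the latter uniform in `ε`, give `3 (η / 8)`; the
  -- rest is the weighted error at `b`. As `ε → 0` the total is at most `η / 2`.
  have bound : ∀ ε, 0 < ε →
      ‖T k - cfc (trigReg q ε) A k‖ ≤ 3 * (η / 8) + (2 * ε + δ) * ‖w‖ := by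
    intro ε hε
    set G := cfc (trigReg q ε) A with hG
    have nG : ‖G‖ ≤ 2 := by
      refine norm_cfc_le zero_le_two fun z hz => ?_
      obtain ⟨a, ha, rfl⟩ := H.spectrum_modularResolvent hz
      exact norm_trigReg_le hq2 hε ha
    have nGT : ‖G b - T b‖ ≤ (2 * ε + δ) * ‖w‖ := by
      have e : G b - T b =
          cfc (fun z : ℂ => (trigReg q ε z - Complex.I * (2 * z - 1)) * (z * (1 - z))) A w := by
        rw [cfc_mul (fun z : ℂ => trigReg q ε z - Complex.I * (2 * z - 1))
          (fun z : ℂ => z * (1 - z)) A ((hc ε hε).sub cT) cB,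
          cfc_sub (trigReg q ε) (fun z : ℂ => Complex.I * (2 * z - 1)) A (hc ε hε) cT, eb]
        rfl
      rw [e]
      refine ContinuousLinearMap.le_of_opNorm_le _ (norm_cfc_le (by positivity) fun z hz => ?_) _
      obtain ⟨a, ha, rfl⟩ := H.spectrum_modularResolvent hz
      exact norm_trigReg_sub_mul_le hq2 ha (hqδ a ha) hε
    have e : T k - G k = T (k - b) - G (k - b) - (G b - T b) := by
      rw [map_sub, map_sub]; abel
    have n1 := ContinuousLinearMap.le_of_opNorm_le T nT (k - b)
    have n2 := ContinuousLinearMap.le_of_opNorm_le G nG (k - b)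
    have n3 := norm_sub_le (T (k - b) - G (k - b)) (G b - T b)
    have n4 := norm_sub_le (T (k - b)) (G (k - b))
    rw [e]
    linarith
  have hfin : ‖T k - y‖ ≤ 3 * (η / 8) + (2 * 0 + δ) * ‖w‖ := by
    refine le_of_tendsto_of_tendsto (hty.const_sub (T k)).norm
      (g := fun ε : ℝ => 3 * (η / 8) + (2 * ε + δ) * ‖w‖) ?_ ?_
    · exact ((by fun_prop : Continuous fun ε : ℝ => 3 * (η / 8) + (2 * ε + δ) * ‖w‖).tendsto
        0).mono_left nhdsWithin_le_nhds
    · filter_upwards [self_mem_nhdsWithin] with ε hε using bound ε hε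
  have hδw : δ * ‖w‖ ≤ η / 8 := by
    rw [hδ, div_mul_eq_mul_div, div_le_iff₀ (by positivity)]
    nlinarith [norm_nonneg w]
  rw [dist_eq_norm]
  linarith

/-- A standard subspace of `H` that is invariant under the modular group of `H` is all of `H`. -/
theorem eq_of_le_of_modularUnitary_mem {K H : StandardSubspace 𝓗}
    (hle : K.toClosedSubmodule ≤ H.toClosedSubmodule)
    (hU : ∀ t, ∀ k ∈ K.toClosedSubmodule, H.modularUnitary t k ∈ K.toClosedSubmodule) : K = H :=
  eq_of_le_of_resolvent_mem hle fun _ hk => resolvent_mem_of_modularUnitary_mem hU hk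

end Limit

end StandardSubspace

end ModularInvariance

theorem lemma3p11 {𝓗 : Type*} [NormedAddCommGroup 𝓗] [InnerProductSpace ℂ 𝓗] [CompleteSpace 𝓗]
    (K H : StandardSubspace 𝓗) (hKH : StandardSubspace.IsHalfSidedModularInclusion K H)
    (hne : K ≠ H) :
    ¬ ∃ Γ : 𝓗 ≃ₗᵢ⋆[ℂ] 𝓗, IsConjugation Γ ∧
      Γ '' (K.toClosedSubmodule : Set 𝓗) = K.toClosedSubmodule ∧
      Γ '' (H.toClosedSubmodule : Set 𝓗) = H.toClosedSubmodule := by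
  rintro ⟨Γ, hΓ, hK, hH⟩
  have hK' : ∀ k ∈ K.toClosedSubmodule, Γ k ∈ K.toClosedSubmodule := fun k hk =>
    hK.subset ⟨k, hk, rfl⟩
  have hH' : ∀ h ∈ H.toClosedSubmodule, Γ h ∈ H.toClosedSubmodule := fun h hh =>
    hH.subset ⟨h, hh, rfl⟩
  refine hne (StandardSubspace.eq_of_le_of_modularUnitary_mem hKH.le fun t k hk => ?_)
  rcases le_total t 0 with ht | ht
  · have := hKH.image_subset (-t) (neg_nonneg.2 ht) ⟨k, hk, rfl⟩
    rwa [neg_neg] at this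
  -- For `t ≥ 0`, `Δ_H^{it} = Γ Δ_H^{-it} Γ` is a composition of maps preserving `K`.
  · rw [← neg_neg t, StandardSubspace.modularUnitary_neg_conjugation hΓ hH' (-t) k]
    exact hK' _ (hKH.image_subset t ht ⟨_, hK' k hk, rfl⟩)
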